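/- Let $l_1,\dots,l_4:\mathbb R^2\to\mathbb R^2$ be the maps $l_1(x,y)=\tfrac13(x,y)$, $l_2(x,y)=\tfrac13\bigl(\tfrac{x-\sqrt3y}{2},\tfrac{\sqrt3x+y}{2}\bigr)+(\tfrac13,0)$, $l_3(x,y)=\tfrac13\bigl(\tfrac{x+\sqrt3y}{2},\tfrac{y-\sqrt3x}{2}\bigr)+(\tfrac12,\tfrac1{2\sqrt3})$, $l_4(x,y)=\tfrac13(x,y)+(\tfrac23,0)$, let $\mathcal V$ be the von Koch curve, i.e. their attractor, let $V_0=\{(0,0),(1,0)\}$ and $V_m=\bigcup_{|w|=m}l_w(V_0)$, where $l_w=l_{w_1}\circ\cdots\circ l_{w_m}$. Fix a regular harmonic structure $(H,r)$ on $\mathcal V$: $H$ is a symmetric real matrix indexed by $V_0$ with nonnegative off-diagonal entries, negative semidefinite, with kernel the constants; $0<r_n<1$ for $n=1,\dots,4$; and with $\mathcal E_0(g)=-(g,Hg)$ and $\mathcal E_m(g)=\sum_{|w|=m}(r_{w_1}\cdots r_{w_m})^{-1}\mathcal E_0(g\circ l_w|_{V_0})$, one has $\min\{\mathcal E_1(g):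 g|_{V_0}=\varphi\}=\mathcal E_0(\varphi)$ for every $\varphi:V_0\to\mathbb R$. (The standard structure has $r_n=\tfrac14$.) A function $h$ on $\mathcal V$ is harmonic if it is continuous and, for every $m\ge1$, minimizes $\mathcal E_m$ among all functions with the same values on $V_0$. Let $J\subset\mathbb R$ be compact, let $u:V_1\to\mathbb R$ satisfy $u(V_0)\subset J$ and be such that the points $(t,u(t))$, $t\in V_1$, of $\mathbb R^3$ are not coplanar, and for $n=1,\dots,4$ let $h_n$ be a nonconstant harmonic function on $\mathcal V$ and $s_n:J\to J$ a map with $|s_n(y)-s_n(y')|<|y-y'|$ for all $y\ne y'$ in $J$, such that $h_n(x)+s_n(y)\in J$ for all $x\in\mathcal V$, $y\in J$, and $h_n(p)+s_n(u(p))=u(l_n(p))$ for all $p\in V_0$. Let $f^*:\mathcal V\to J$ be the nonlinear fractal interpolation function with these data, i.e. the continuous function with $f^*|_{V_1}=u$ and $$f^*(l_n(x))=s_n(f^*(x))+h_n(x)\qquad(x\in\mathcal V,\ n=1,\dots,4).$$ Let $G=\{(x,f^*(x)):x\in\mathcal V\}\subset\mathbb R^3$ and $\mu=\sum_{n=1}^4L(s_n)$,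 where $L(s_n)=\sup_{y\ne y'}\frac{|s_n(y)-s_n(y')|}{|y-y'|}$ over $y,y'\in J$. With $\overline{\dim}_B(G)=\limsup_{\delta\to0^+}\frac{\log N_\delta(G)}{-\log\delta}$, where $N_\delta(G)$ is the least number of cubes of side length $\delta$ that cover $G$: (i) if $\mu>2$, then $\overline{\dim}_B(G)\le1+\frac{\log\mu}{\log3}$; (ii) if $\mu\le2$, then $\overline{\dim}_B(G)\le\frac{\log6}{\log3}\approx1.631$. -/

import Mathlib

open Set Filter Topology

noncomputable section

/-- The Euclidean plane. -/
abbrev Plane : Type := EuclideanSpace ℝ (Fin 2)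

/-- Euclidean three-space, in which the graphs live. -/
abbrev Space : Type := EuclideanSpace ℝ (Fin 3)

/-! ### The von Koch curve -/

/-- The four similarities of ratio `1/3` generating the von Koch curve on the segment from
`(0,0)` to `(1,0)` (indexed by `0, 1, 2, 3` instead of `1, 2, 3, 4`). -/
def kochMap (n : Fin 4) (x : Plane) : Plane :=
  match n with
  | 0 => !₂[x 0 / 3, x 1 / 3]
  | 1 => !₂[(x 0 - √3 * x 1) / 6 + 1 / 3, (√3 * x 0 + x 1) / 6]
  | 2 => !₂[(x 0 + √3 * x 1) / 6 + 1 / 2, (x 1 - √3 * x 0) / 6 + 1 / (2 * √3)]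
  | 3 => !₂[x 0 / 3 + 2 / 3, x 1 / 3]

/-- `kochWord w = l_{w₁} ∘ ⋯ ∘ l_{wₘ}` for a word `w = w₁ ⋯ wₘ`. -/
def kochWord : {m : ℕ} → (Fin m → Fin 4) → Plane → Plane
  | 0, _, x => x
  | _ + 1, w, x => kochMap (w 0) (kochWord (Fin.tail w) x)

/-- The two boundary points of the von Koch curve, `(0,0)` and `(1,0)`; they form `V₀`. -/
def kochEnd (j : Fin 2) : Plane :=
  match j with
  | 0 => !₂[0, 0]
  | 1 => !₂[1, 0]

/-- The vertex set `V_m`, the union of the sets `l_w(V₀)` over all words `w` of length `m`. -/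
def kochVertices (m : ℕ) : Set Plane :=
  {x | ∃ (w : Fin m → Fin 4) (j : Fin 2), x = kochWord w (kochEnd j)}

/-- The von Koch curve, as the closure of `V_* = ⋃ V_m`. It is the attractor of the four maps
`kochMap`, see `eq_kochCurve_iff` below. -/
def kochCurve : Set Plane := closure (⋃ m, kochVertices m)

theorem dist_kochMap (n : Fin 4) (x y : Plane) :
    dist (kochMap n x) (kochMap n y) = dist x y / 3 := by
  have h3 : √3 ^ 2 = (3 : ℝ) := Real.sq_sqrt (by norm_num)
  rw [EuclideanSpace.dist_eq, EuclideanSpace.dist_eq, Fin.sum_univ_two, Fin.sum_univ_two,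
    ← sq_eq_sq₀ (by positivity) (by positivity), div_pow, Real.sq_sqrt (by positivity),
    Real.sq_sqrt (by positivity)]
  simp only [Real.dist_eq, sq_abs]
  fin_cases n <;> simp [kochMap] <;> grind

theorem continuous_kochMap (n : Fin 4) : Continuous (kochMap n) :=
  (LipschitzWith.of_dist_le_mul (K := 1) fun x y => by
    rw [dist_kochMap]
    have := dist_nonneg (x := x) (y := y)
    simp only [NNReal.coe_one, one_mul]
    linarith).continuous

theorem kochMap_zero_kochEnd : kochMap 0 (kochEnd 0) = kochEnd 0 := by
  ext i; fin_cases i <;> simp [kochMap, kochEnd]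

theorem kochMap_three_kochEnd : kochMap 3 (kochEnd 1) = kochEnd 1 := by
  ext i; fin_cases i <;> simp [kochMap, kochEnd]; norm_num

theorem iUnion_kochVertices :
    (⋃ m, kochVertices m) = ⋃ n, kochMap n '' (⋃ m, kochVertices m) := by
  ext x
  simp only [mem_iUnion, mem_image, kochVertices, mem_ofPred_eq]
  constructor
  · rintro ⟨m, w, j, rfl⟩
    cases m with
    | zero =>
      fin_cases j
      · exact ⟨0, kochEnd 0, ⟨0, Fin.elim0, 0, rfl⟩, kochMap_zero_kochEnd⟩
      · exact ⟨3, kochEnd 1, ⟨0, Fin.elim0, 1, rfl⟩, kochMap_three_kochEnd⟩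
    | succ m => exact ⟨w 0, _, ⟨m, Fin.tail w, j, rfl⟩, rfl⟩
  · rintro ⟨n, _, ⟨m, w, j, rfl⟩, rfl⟩
    exact ⟨m + 1, Fin.cons n w, j, by simp [kochWord]⟩

theorem isCompact_kochCurve : IsCompact kochCurve := by
  have h3 : √3 ^ 2 = (3 : ℝ) := Real.sq_sqrt (by norm_num)
  have hn : ∀ n, ‖kochMap n 0‖ ≤ 2 / 3 := fun n => by
    rw [EuclideanSpace.norm_eq, Fin.sum_univ_two]
    apply Real.sqrt_le_iff.2
    fin_cases n <;> simp [kochMap] <;> norm_num [mul_pow]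
  have hV : (⋃ m, kochVertices m) ⊆ Metric.closedBall (0 : Plane) 1 := by
    refine iUnion_subset fun m => ?_
    rintro _ ⟨w, j, rfl⟩
    induction m with
    | zero => fin_cases j <;> simp [kochWord, kochEnd, EuclideanSpace.norm_eq]
    | succ m ih =>
      have h1 := ih (Fin.tail w)
      have h2 := dist_kochMap (w 0) (kochWord (Fin.tail w) (kochEnd j)) 0
      have h4 := dist_triangle (kochMap (w 0) (kochWord (Fin.tail w) (kochEnd j)))
        (kochMap (w 0) 0) 0
      have h5 := hn (w 0)
      rw [← dist_zero_right] at h5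
      rw [Metric.mem_closedBall] at h1 ⊢
      simp only [kochWord]
      linarith
  exact (isCompact_closedBall (0 : Plane) 1).of_isClosed_subset isClosed_closure
    (closure_minimal hV Metric.isClosed_closedBall)

theorem nonempty_kochCurve : kochCurve.Nonempty :=
  ⟨kochEnd 0, subset_closure (mem_iUnion.2 ⟨0, Fin.elim0, 0, rfl⟩)⟩

theorem kochCurve_eq_iUnion : kochCurve = ⋃ n, kochMap n '' kochCurve := by
  have h : ∀ n, kochMap n '' kochCurve = closure (kochMap n '' (⋃ m, kochVertices m)) :=
    fun n => image_closure_of_isCompact isCompact_kochCurve (continuous_kochMap n).continuousOn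
  simp only [h]
  rw [← closure_iUnion_of_finite, ← iUnion_kochVertices, kochCurve]

/-- The von Koch curve is the unique nonempty compact set `K` with `K = ⋃ₙ lₙ(K)`. -/
theorem eq_kochCurve_iff :
    ∀ A : Set Plane, (A.Nonempty ∧ IsCompact A ∧ A = ⋃ n, kochMap n '' A) ↔ A = kochCurve := by
  have key : ∀ A B : Set Plane, A.Nonempty → IsCompact A → A = ⋃ n, kochMap n '' A →
      B.Nonempty → IsCompact B → B = ⋃ n, kochMap n '' B → A ⊆ B := by
    intro A B hA hAc hAe hB hBc hBe
    obtain ⟨a, ha, hmax⟩ := hAc.exists_isMaxOn hA (Metric.continuous_infDist_pt B).continuousOn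
    have ha' := ha
    rw [hAe] at ha'
    obtain ⟨n, b, hb, rfl⟩ := mem_iUnion.1 ha'
    obtain ⟨c, hc, hbc⟩ := hBc.exists_infDist_eq_dist hB b
    have hc' : kochMap n c ∈ B := by rw [hBe]; exact mem_iUnion.2 ⟨n, c, hc, rfl⟩
    have h1 := Metric.infDist_le_dist_of_mem (x := kochMap n b) hc'
    rw [dist_kochMap, ← hbc] at h1
    have h2 : Metric.infDist b B ≤ Metric.infDist (kochMap n b) B := hmax hb
    intro x hx
    have h3 : Metric.infDist x B ≤ Metric.infDist (kochMap n b) B := hmax hx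
    have h4 : 0 ≤ Metric.infDist x B := Metric.infDist_nonneg
    exact (hBc.isClosed.mem_iff_infDist_zero hB).2 (by linarith)
  intro A
  constructor
  · rintro ⟨h1, h2, h3⟩
    exact (key _ _ h1 h2 h3 nonempty_kochCurve isCompact_kochCurve kochCurve_eq_iUnion).antisymm
      (key _ _ nonempty_kochCurve isCompact_kochCurve kochCurve_eq_iUnion h1 h2 h3)
  · rintro rfl
    exact ⟨nonempty_kochCurve, isCompact_kochCurve, kochCurve_eq_iUnion⟩

/-! ### Energies and harmonic functions on the von Koch curve -/

/-- A Laplace matrix on `V₀`, whose points are indexed by `Fin 2`. -/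
structure IsLaplaceMatrix (H : Matrix (Fin 2) (Fin 2) ℝ) : Prop where
  symm : ∀ p q, H p q = H q p
  nonneg : ∀ p q, p ≠ q → 0 ≤ H p q
  nonpos : ∀ f : Fin 2 → ℝ, dotProduct f (H.mulVec f) ≤ 0
  ker : ∀ f : Fin 2 → ℝ, H.mulVec f = 0 ↔ ∃ c, ∀ p, f p = c

/-- The energy form on functions on `V₀`, `𝓔₀(f) = -(f, H f)`. -/
def energyZero (H : Matrix (Fin 2) (Fin 2) ℝ) (f : Fin 2 → ℝ) : ℝ :=
  -dotProduct f (H.mulVec f)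

/-- The energy form at level `m`,
`𝓔_m(u) = ∑_{|w| = m} (r_{w₁} ⋯ r_{wₘ})⁻¹ 𝓔₀(u ∘ l_w restricted to V₀)`.
Only the values of `u` on `V_m` matter. -/
def kochEnergy (H : Matrix (Fin 2) (Fin 2) ℝ) (r : Fin 4 → ℝ) (m : ℕ) (u : Plane → ℝ) : ℝ :=
  ∑ w : Fin m → Fin 4, (∏ i, r (w i))⁻¹ * energyZero H (fun j => u (kochWord w (kochEnd j)))

/-- `(H, r)` is a regular harmonic structure on the von Koch curve: `H` is a Laplace matrix,
`0 < r_i < 1`, and for all boundary values `f` on `V₀` the minimum of `𝓔₁` over the extensions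
of `f` to `V₁` is `𝓔₀(f)`. -/
structure IsRegularHarmonicStructure (H : Matrix (Fin 2) (Fin 2) ℝ) (r : Fin 4 → ℝ) : Prop where
  laplace : IsLaplaceMatrix H
  pos : ∀ i, 0 < r i
  lt_one : ∀ i, r i < 1
  isLeast : ∀ f : Fin 2 → ℝ,
    IsLeast {e | ∃ g : Plane → ℝ, (∀ j, g (kochEnd j) = f j) ∧ e = kochEnergy H r 1 g}
      (energyZero H f)

/-- `h` is harmonic on the von Koch curve: it is continuous there and at each level it minimizes
the energy among all functions with the same values on `V₀`. -/
def IsKochHarmonic (H : Matrix (Fin 2) (Fin 2) ℝ) (r : Fin 4 → ℝ) (h : Plane → ℝ) : Prop :=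
  ContinuousOn h kochCurve ∧
    ∀ m : ℕ, 1 ≤ m → ∀ g : Plane → ℝ, (∀ j, g (kochEnd j) = h (kochEnd j)) →
      kochEnergy H r m h ≤ kochEnergy H r m g

/-! ### The nonlinear fractal interpolation function -/

/-- `s` restricts to an Edelstein contraction of `J`. -/
def IsEdelsteinOn (J : Set ℝ) (s : ℝ → ℝ) : Prop :=
  MapsTo s J J ∧ ∀ x ∈ J, ∀ y ∈ J, x ≠ y → dist (s x) (s y) < dist x y

/-- The upper Lipschitz constant `L(s)` of `s` on `J`. -/
def upperLipschitz (J : Set ℝ) (s : ℝ → ℝ) : ℝ :=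
  sSup {t | ∃ x ∈ J, ∃ y ∈ J, x ≠ y ∧ t = dist (s x) (s y) / dist x y}

/-- The data of a nonlinear IFS `(x, y) ↦ (l_n x, h_n x + s_n y)` on `kochCurve × J`
for the interpolation data `u` on `V₁`. -/
structure IsNonlinearKochIFS (H : Matrix (Fin 2) (Fin 2) ℝ) (r : Fin 4 → ℝ) (J : Set ℝ)
    (u : Plane → ℝ) (h : Fin 4 → Plane → ℝ) (s : Fin 4 → ℝ → ℝ) : Prop where
  compact : IsCompact J
  harmonic : ∀ n, IsKochHarmonic H r (h n)
  nonconstant : ∀ n, ¬ ∃ c, ∀ x ∈ kochCurve, h n x = c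
  edelstein : ∀ n, IsEdelsteinOn J (s n)
  mapsTo : ∀ n, ∀ x ∈ kochCurve, ∀ y ∈ J, h n x + s n y ∈ J
  data_mem : ∀ j, u (kochEnd j) ∈ J
  join : ∀ n j, h n (kochEnd j) + s n (u (kochEnd j)) = u (kochMap n (kochEnd j))

/-- `f` is the nonlinear fractal interpolation function: the continuous `J`-valued function on
the von Koch curve that interpolates `u` on `V₁` and has a graph invariant under the IFS. -/
structure IsNonlinearKochFIF (J : Set ℝ) (u : Plane → ℝ) (h : Fin 4 → Plane → ℝ)
    (s : Fin 4 → ℝ → ℝ) (f : Plane → ℝ) : Prop where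
  continuousOn : ContinuousOn f kochCurve
  mapsTo : MapsTo f kochCurve J
  interpolates : ∀ t ∈ kochVertices 1, f t = u t
  invariant : ∀ n, ∀ x ∈ kochCurve, f (kochMap n x) = s n (f x) + h n x

/-- The point `(x, y)` of `ℝ³`, for `x` in the plane and `y` real. -/
def graphPoint (x : Plane) (y : ℝ) : Space := !₂[x 0, x 1, y]

/-- The graph of `f` over `A`. -/
def graphOver (A : Set Plane) (f : Plane → ℝ) : Set Space := (fun x => graphPoint x (f x)) '' A

/-! ### Box dimension -/

/-- The axis-parallel closed cube of side length `δ` with lowest corner `a`. -/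
def cube (a : Space) (δ : ℝ) : Set Space := {x | ∀ i, x i ∈ Icc (a i) (a i + δ)}

/-- The least number of cubes of side length `δ` that cover the (bounded) set `F`. -/
def boxCount (F : Set Space) (δ : ℝ) : ℕ :=
  sInf {k | ∃ t : Finset Space, t.card = k ∧ F ⊆ ⋃ a ∈ t, cube a δ}

/-- The upper box-counting dimension of a bounded set. -/
def upperBoxDim (F : Set Space) : EReal :=
  limsup (fun δ : ℝ => ((Real.log (boxCount F δ) / -Real.log δ : ℝ) : EReal)) (𝓝[>] 0)

end

/-! ### Combinatorics of words -/

/-! The von Koch curve is an arc and `V₁` is a path of four edges, so harmonic structures behave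
like resistors in series. `H` reduces to one positive conductance, and regularity forces `∑ r n = 1`
(`IsRegularHarmonicStructure.sum_eq_one`). A harmonic function with boundary increment `c` then has
increment `c * ∏ r (w i)` on the cell `w` (`IsKochHarmonic.wordIncrement_eq`), which up to sign is
also its oscillation there (`abs_sub_le_of_wordIncrement`). At every level, the oscillations of each
`h n` over all cells thus have bounded sum.

The functional equation bounds the oscillation of `f` on the cell `n w` by `L(s n)` times its
oscillation on `w`, plus that of `h n` on `w`. Summing over cells gives `S (m+1) ≤ μ * S m + C`,
hence `S m = O(M ^ m)` for any `M ≥ max μ 2` (`exists_sum_oscillation_le`).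

At scale `δ ≈ 3 ^ (-m)` the graph over each of the `4 ^ m` cells lies in boundedly many columns of
height comparable to the oscillation of `f`. The count is `O(3 ^ m * M ^ m + 4 ^ m) = O((3 * M) ^
m)`, giving dimension at most `log (3 * M) / log 3`; take `M = μ` or `M = 2`. -/

theorem kochWord_cons {m : ℕ} (n : Fin 4) (w : Fin m → Fin 4) (x : Plane) :
    kochWord (Fin.cons n w : Fin (m + 1) → Fin 4) x = kochMap n (kochWord w x) := by
  simp [kochWord]

theorem sum_word_succ {m : ℕ} (F : (Fin (m + 1) → Fin 4) → ℝ) :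
    ∑ w, F w = ∑ n : Fin 4, ∑ w : Fin m → Fin 4, F (Fin.cons n w) := by
  rw [← (Fin.consEquiv fun _ : Fin (m + 1) => Fin 4).sum_comp, Fintype.sum_prod_type]
  rfl

theorem sum_word_prod (ρ : Fin 4 → ℝ) (hρ : ∑ n, ρ n = 1) (m : ℕ) :
    ∑ w : Fin m → Fin 4, ∏ i, ρ (w i) = 1 := by
  induction m with
  | zero => simp
  | succ m ih =>
    simp only [sum_word_succ, Fin.prod_univ_succ, Fin.cons_zero, Fin.cons_succ, ← Finset.mul_sum,
      ih, mul_one, hρ]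

theorem kochMap_kochEnd_one (n : Fin 3) :
    kochMap n.castSucc (kochEnd 1) = kochMap n.succ (kochEnd 0) := by
  have h3 : √3 ^ 2 = (3 : ℝ) := Real.sq_sqrt (by norm_num)
  have h0 : √3 ≠ (0 : ℝ) := by positivity
  ext i
  fin_cases n <;> fin_cases i <;> simp [kochMap, kochEnd] <;> grind

/-- The increment of `g` between the two ends of the cell of the word `w`. -/
noncomputable def wordIncrement (g : Plane → ℝ) {m : ℕ} (w : Fin m → Fin 4) : ℝ :=
  g (kochWord w (kochEnd 1)) - g (kochWord w (kochEnd 0))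

theorem wordIncrement_cons (g : Plane → ℝ) {m : ℕ} (n : Fin 4) (w : Fin m → Fin 4) :
    wordIncrement g (Fin.cons n w : Fin (m + 1) → Fin 4) =
      wordIncrement (fun x => g (kochMap n x)) w := by
  simp only [wordIncrement, kochWord_cons]

/-- Consecutive pieces share an end point, so the sum telescopes. -/
theorem sum_increment_kochMap (g : Plane → ℝ) :
    ∑ n, (g (kochMap n (kochEnd 1)) - g (kochMap n (kochEnd 0))) =
      g (kochEnd 1) - g (kochEnd 0) := by
  have h0 := kochMap_kochEnd_one 0
  have h1 := kochMap_kochEnd_one 1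
  have h2 := kochMap_kochEnd_one 2
  simp only [Fin.isValue, Fin.castSucc_zero, Fin.succ_zero_eq_one, Fin.castSucc_one,
    Fin.succ_one_eq_two, Fin.reduceCastSucc, Fin.reduceSucc] at h0 h1 h2
  rw [Fin.sum_univ_four, h0, h1, h2, kochMap_three_kochEnd, kochMap_zero_kochEnd]
  ring

theorem sum_wordIncrement (m : ℕ) (g : Plane → ℝ) :
    ∑ w : Fin m → Fin 4, wordIncrement g w = g (kochEnd 1) - g (kochEnd 0) := by
  induction m generalizing g with
  | zero => simp [wordIncrement, kochWord]
  | succ m ih =>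
    simp only [sum_word_succ, wordIncrement_cons, ih, sum_increment_kochMap]

theorem kochMap_mem_kochCurve (n : Fin 4) {x : Plane} (hx : x ∈ kochCurve) :
    kochMap n x ∈ kochCurve := by
  rw [kochCurve_eq_iUnion]
  exact mem_iUnion.2 ⟨n, x, hx, rfl⟩

theorem kochWord_mem_kochCurve {m : ℕ} (w : Fin m → Fin 4) {x : Plane} (hx : x ∈ kochCurve) :
    kochWord w x ∈ kochCurve := by
  induction m with
  | zero => exact hx
  | succ m ih => exact kochMap_mem_kochCurve _ (ih _)

theorem exists_kochWord_eq (m : ℕ) {x : Plane} (hx : x ∈ kochCurve) :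
    ∃ (w : Fin m → Fin 4), ∃ y ∈ kochCurve, x = kochWord w y := by
  induction m generalizing x with
  | zero => exact ⟨Fin.elim0, x, hx, rfl⟩
  | succ m ih =>
    rw [kochCurve_eq_iUnion] at hx
    obtain ⟨n, y, hy, rfl⟩ := mem_iUnion.1 hx
    obtain ⟨w, z, hz, rfl⟩ := ih hy
    exact ⟨Fin.cons n w, z, hz, (kochWord_cons n w z).symm⟩

theorem dist_kochWord {m : ℕ} (w : Fin m → Fin 4) (x y : Plane) :
    dist (kochWord w x) (kochWord w y) = (1 / 3) ^ m * dist x y := by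
  induction m with
  | zero => simp [kochWord]
  | succ m ih => rw [kochWord, kochWord, dist_kochMap, ih]; ring

/-! ### Distinctness of the vertices -/

/-- The triangle spanned by the von Koch curve, without its right-hand corner. -/
def halfOpenTriangle : Set Plane :=
  {x | 0 ≤ x 1 ∧ √3 * x 1 ≤ x 0 ∧ √3 * x 1 ≤ 1 - x 0 ∧ x 0 < 1}

theorem kochEnd_zero_mem_halfOpenTriangle : kochEnd 0 ∈ halfOpenTriangle := by
  simp [halfOpenTriangle, kochEnd]

theorem kochEnd_one_notMem_halfOpenTriangle : kochEnd 1 ∉ halfOpenTriangle := by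
  simp [halfOpenTriangle, kochEnd]

theorem kochMap_mem_halfOpenTriangle (n : Fin 4) {x : Plane} (hx : x ∈ halfOpenTriangle) :
    kochMap n x ∈ halfOpenTriangle := by
  have h3 : √3 * √3 = (3 : ℝ) := Real.mul_self_sqrt (by norm_num)
  have hp : 0 < √(3 : ℝ) := by positivity
  have hi : 1 / (2 * √3) = √3 / (6 : ℝ) := by field_simp; linarith
  obtain ⟨h0, h1, h2, h4⟩ := hx
  have e1 : √3 * (√3 * x 1) = 3 * x 1 := by rw [← mul_assoc, h3]
  have e0 : √3 * (√3 * x 0) = 3 * x 0 := by rw [← mul_assoc, h3]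
  have p1 : 0 ≤ √3 * x 1 := by positivity
  have p0 : 0 ≤ √3 * x 0 := mul_nonneg hp.le (p1.trans h1)
  have p2 : √3 * x 0 ≤ √3 * (1 - √3 * x 1) := mul_le_mul_of_nonneg_left (by linarith) hp.le
  have p3 : √3 * x 0 ≤ √3 * 1 := mul_le_mul_of_nonneg_left h4.le hp.le
  fin_cases n <;> simp only [halfOpenTriangle, kochMap, mem_ofPred_eq] <;>
    refine ⟨?_, ?_, ?_, ?_⟩ <;> simp [-one_div, hi] <;> nlinarith

theorem kochMap_injective (n : Fin 4) : Function.Injective (kochMap n) := fun x y hxy => by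
  have h := dist_kochMap n x y
  rw [hxy, dist_self] at h
  exact dist_eq_zero.1 (by linarith)

/-- Images of the full triangle meet only where the right corner of one is the left corner of the
next; omitting right corners makes them disjoint. -/
theorem kochMap_ne_of_lt {n k : Fin 4} (hnk : n < k) {x y : Plane} (hx : x ∈ halfOpenTriangle)
    (hy : y ∈ halfOpenTriangle) : kochMap n x ≠ kochMap k y := by
  intro he
  have h3 : √3 * √3 = (3 : ℝ) := Real.mul_self_sqrt (by norm_num)
  have hp : 0 < √(3 : ℝ) := by positivity
  have hi : 1 / (2 * √3) = √3 / (6 : ℝ) := by field_simp; linarith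
  obtain ⟨x0, x1, x2, x3⟩ := hx
  obtain ⟨y0, y1, y2, y3⟩ := hy
  have e0 := congrArg (fun z : Plane => z 0) he
  have e1 := congrArg (fun z : Plane => z 1) he
  have px : 0 ≤ √3 * x 1 := by positivity
  have py : 0 ≤ √3 * y 1 := by positivity
  fin_cases n <;> fin_cases k <;> first
    | exact absurd hnk (by decide)
    | (simp [-one_div, hi, kochMap] at e0 e1; nlinarith)

theorem kochMap_pair_injective :
    Function.Injective fun p : Fin 4 × halfOpenTriangle => kochMap p.1 p.2 := by
  rintro ⟨n, x⟩ ⟨k, y⟩ he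
  rcases lt_trichotomy n k with h | rfl | h
  · exact absurd he (kochMap_ne_of_lt h x.2 y.2)
  · simp only [Prod.mk.injEq, true_and]
    exact Subtype.ext (kochMap_injective n he)
  · exact absurd he.symm (kochMap_ne_of_lt h y.2 x.2)

theorem kochWord_kochEnd_mem {m : ℕ} (w : Fin m → Fin 4) (j : Fin 2) :
    kochWord w (kochEnd j) ∈ insert (kochEnd 1) halfOpenTriangle := by
  induction m with
  | zero =>
    fin_cases j
    · exact Or.inr kochEnd_zero_mem_halfOpenTriangle
    · exact Or.inl rfl
  | succ m ih =>
    rcases ih (Fin.tail w) with h | h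
    · rw [kochWord, h]
      generalize w 0 = n
      induction n using Fin.lastCases with
      | last => exact Or.inl kochMap_three_kochEnd
      | cast n =>
        rw [kochMap_kochEnd_one]
        exact Or.inr (kochMap_mem_halfOpenTriangle _ kochEnd_zero_mem_halfOpenTriangle)
    · exact Or.inr (kochMap_mem_halfOpenTriangle _ h)

/-- Supplies the competitors in the energy minimization. Prescribing increments is consistent
because vertices of distinct cells coincide only at shared ends of neighbours. -/
theorem exists_wordIncrement_eq (ρ : Fin 4 → ℝ) (hρ : ∑ n, ρ n = 1) (m : ℕ) :
    ∃ g : Plane → ℝ, g (kochEnd 0) = 0 ∧ g (kochEnd 1) = 1 ∧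
      ∀ w : Fin m → Fin 4, wordIncrement g w = ∏ i, ρ (w i) := by
  induction m with
  | zero =>
    exact ⟨fun x => x 0, by simp [kochEnd], by simp [kochEnd], fun w => by
      simp [wordIncrement, kochWord, kochEnd]⟩
  | succ m ih =>
    obtain ⟨g, g0, g1, hg⟩ := ih
    -- On the piece `n`, a copy of `g` scaled by `ρ n` starts at the partial sum of the earlier
    -- weights. The default value `1` matters: it is the value at the omitted corner `kochEnd 1`.
    let F : Plane → ℝ := Function.extend (fun p : Fin 4 × halfOpenTriangle => kochMap p.1 p.2)
      (fun p => ∑ k ∈ Finset.Iio p.1, ρ k + ρ p.1 * g p.2) fun _ => 1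
    have hF : ∀ n, ∀ x ∈ halfOpenTriangle,
        F (kochMap n x) = ∑ k ∈ Finset.Iio n, ρ k + ρ n * g x := fun n x hx =>
      kochMap_pair_injective.extend_apply _ _ (n, ⟨x, hx⟩)
    have hF1 : F (kochEnd 1) = 1 := by
      refine Function.extend_apply' _ _ _ ?_
      rintro ⟨⟨n, x⟩, hx⟩
      exact kochEnd_one_notMem_halfOpenTriangle (hx ▸ kochMap_mem_halfOpenTriangle n x.2)
    have hF' : ∀ n, ∀ x ∈ insert (kochEnd 1) halfOpenTriangle,
        F (kochMap n x) = ∑ k ∈ Finset.Iio n, ρ k + ρ n * g x := by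
      rintro n x (rfl | hx)
      · rw [g1, mul_one, Finset.sum_Iio_add_eq_sum_Iic]
        induction n using Fin.lastCases with
        | last =>
          rw [show Fin.last 3 = 3 from rfl, kochMap_three_kochEnd, hF1, ← hρ]
          rfl
        | cast n =>
          rw [kochMap_kochEnd_one, hF _ _ kochEnd_zero_mem_halfOpenTriangle, g0, mul_zero,
            add_zero]
          congr 1
      · exact hF n x hx
    refine ⟨F, ?_, hF1, fun w => ?_⟩
    · rw [← kochMap_zero_kochEnd, hF _ _ kochEnd_zero_mem_halfOpenTriangle, g0,
        show Finset.Iio (0 : Fin 4) = ∅ from rfl]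
      simp
    · rw [← Fin.cons_self_tail w, wordIncrement_cons, wordIncrement,
        hF' _ _ (kochWord_kochEnd_mem _ _), hF' _ _ (kochWord_kochEnd_mem _ _),
        Fin.prod_univ_succ]
      simp only [Fin.cons_zero, Fin.cons_succ, ← hg, wordIncrement]
      ring

/-! ### Harmonic functions -/

/-- Constants lie in the kernel, so rows sum to zero and symmetry leaves a single parameter. -/
theorem IsLaplaceMatrix.energyZero_eq {H : Matrix (Fin 2) (Fin 2) ℝ} (hH : IsLaplaceMatrix H)
    (f : Fin 2 → ℝ) : energyZero H f = H 0 1 * (f 1 - f 0) ^ 2 := by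
  have h := (hH.ker fun _ => 1).2 ⟨1, fun _ => rfl⟩
  have h0 := congrFun h 0
  have h1 := congrFun h 1
  have hs := hH.symm 0 1
  simp only [Matrix.mulVec, dotProduct, Fin.sum_univ_two, Pi.zero_apply, mul_one] at h0 h1
  simp only [energyZero, Matrix.mulVec, dotProduct, Fin.sum_univ_two]
  rw [show H 0 0 = -H 0 1 by linarith, show H 1 1 = -H 0 1 by linarith, ← hs]
  ring

theorem IsLaplaceMatrix.pos {H : Matrix (Fin 2) (Fin 2) ℝ} (hH : IsLaplaceMatrix H) :
    0 < H 0 1 := by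
  refine (hH.nonneg 0 1 (by decide)).lt_of_ne fun h0 => ?_
  have h := (hH.ker fun _ => 1).2 ⟨1, fun _ => rfl⟩
  have e0 := congrFun h 0
  have e1 := congrFun h 1
  have hs := hH.symm 0 1
  simp only [Matrix.mulVec, dotProduct, Fin.sum_univ_two, Pi.zero_apply, mul_one] at e0 e1
  obtain ⟨c, hc⟩ := (hH.ker ![0, 1]).1 (by
    ext i
    fin_cases i <;> simp [Matrix.mulVec, dotProduct, Fin.sum_univ_two] <;> linarith)
  simpa using (hc 0).trans (hc 1).symm

theorem IsLaplaceMatrix.kochEnergy_eq {H : Matrix (Fin 2) (Fin 2) ℝ} (hH : IsLaplaceMatrix H)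
    (r : Fin 4 → ℝ) (m : ℕ) (g : Plane → ℝ) :
    kochEnergy H r m g =
      H 0 1 * ∑ w : Fin m → Fin 4, (∏ i, r (w i))⁻¹ * wordIncrement g w ^ 2 := by
  simp only [kochEnergy, hH.energyZero_eq, Finset.mul_sum, wordIncrement]
  exact Finset.sum_congr rfl fun w _ => by ring

/-- Resistances in series add. With boundary values `0, 1`, the competitor with increments
proportional to `r` has energy `H 0 1 / ∑ r n`, so the sum is at most `1`; Cauchy–Schwarz applied to
a minimizer gives the converse. -/
theorem IsRegularHarmonicStructure.sum_eq_one {H : Matrix (Fin 2) (Fin 2) ℝ} {r : Fin 4 → ℝ}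
    (hHr : IsRegularHarmonicStructure H r) : ∑ n, r n = 1 := by
  have hH := hHr.laplace
  have ha := hH.pos
  have hpos : 0 < ∑ n, r n := Finset.sum_pos (fun n _ => hHr.pos n) ⟨0, Finset.mem_univ _⟩
  obtain ⟨⟨g, hg, he⟩, hle⟩ := hHr.isLeast ![0, 1]
  have hw : ∀ F : (Fin 1 → Fin 4) → ℝ, ∑ w, F w = ∑ n, F fun _ => n := fun F =>
    ((Equiv.funUnique (Fin 1) (Fin 4)).symm.sum_comp F).symm
  have hen : energyZero H ![0, 1] = H 0 1 := by simp [hH.energyZero_eq]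
  refine le_antisymm ?_ ?_
  · obtain ⟨g', h0, h1, hg'⟩ := exists_wordIncrement_eq (fun n => r n / ∑ k, r k)
      (by rw [← Finset.sum_div, div_self hpos.ne']) 1
    have := hle ⟨g', fun j => by fin_cases j <;> simp [h0, h1], rfl⟩
    rw [hen, hH.kochEnergy_eq, hw, le_mul_iff_one_le_right ha] at this
    simp only [hg', Finset.univ_unique, Finset.prod_const, Finset.card_singleton, pow_one] at this
    have e : ∀ n, (r n)⁻¹ * (r n / ∑ k, r k) ^ 2 = r n / (∑ k, r k) ^ 2 := fun n => by
      have := (hHr.pos n).ne'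
      field_simp
    simp only [e, ← Finset.sum_div] at this
    rw [one_le_div (by positivity), sq] at this
    exact (mul_le_iff_le_one_right hpos).1 this
  · rw [hen, hH.kochEnergy_eq, hw] at he
    have he' := (mul_right_eq_self₀.1 he.symm).resolve_right ha.ne'
    have hs := sum_wordIncrement 1 g
    rw [hw, hg, hg] at hs
    simp only [Finset.univ_unique, Finset.prod_const, Finset.card_singleton, pow_one] at he'
    have hcs := Finset.sum_sq_le_sum_mul_sum_of_sq_le_mul Finset.univ
      (r := fun n : Fin 4 => wordIncrement g fun _ : Fin 1 => n) (f := r)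
      (g := fun n => (r n)⁻¹ * (wordIncrement g fun _ : Fin 1 => n) ^ 2)
      (fun n _ => (hHr.pos n).le)
      (fun n _ => mul_nonneg (inv_nonneg.2 (hHr.pos n).le) (sq_nonneg _))
      (fun n _ => by rw [mul_inv_cancel_left₀ (hHr.pos n).ne'])
    rw [hs, he'] at hcs
    simpa using hcs

theorem IsKochHarmonic.wordIncrement_eq {H : Matrix (Fin 2) (Fin 2) ℝ} {r : Fin 4 → ℝ}
    (hHr : IsRegularHarmonicStructure H r) {h : Plane → ℝ} (hh : IsKochHarmonic H r h) {m : ℕ}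
    (w : Fin m → Fin 4) :
    wordIncrement h w = (h (kochEnd 1) - h (kochEnd 0)) * ∏ i, r (w i) := by
  rcases m.eq_zero_or_pos with rfl | hm
  · simp [wordIncrement, kochWord]
  have hH := hHr.laplace
  obtain ⟨g, g0, g1, hg⟩ := exists_wordIncrement_eq r hHr.sum_eq_one m
  set c := h (kochEnd 1) - h (kochEnd 0) with hc
  have hr : ∀ w : Fin m → Fin 4, 0 < ∏ i, r (w i) := fun w =>
    Finset.prod_pos fun i _ => hHr.pos _
  have h1 := hh.2 m hm (fun x => h (kochEnd 0) + c * g x) fun j => by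
    fin_cases j <;> simp [g0, g1, hc]
  rw [hH.kochEnergy_eq, hH.kochEnergy_eq, mul_le_mul_iff_right₀ hH.pos] at h1
  have h2 : ∀ w : Fin m → Fin 4,
      wordIncrement (fun x => h (kochEnd 0) + c * g x) w = c * ∏ i, r (w i) := fun w => by
    rw [← hg w, wordIncrement, wordIncrement]; ring
  -- Expanding the square, the increments of `h` sum to `c` and the products of `r` to `1`, so this
  -- sum is the energy of `h` minus that of the competitor, up to the factor `H 0 1`.
  have h3 : ∑ w : Fin m → Fin 4, (∏ i, r (w i))⁻¹ *
      (wordIncrement h w - c * ∏ i, r (w i)) ^ 2 ≤ 0 := by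
    have e : ∀ w : Fin m → Fin 4, (∏ i, r (w i))⁻¹ * (wordIncrement h w - c * ∏ i, r (w i)) ^ 2 =
        (∏ i, r (w i))⁻¹ * wordIncrement h w ^ 2 - 2 * c * wordIncrement h w +
          c ^ 2 * ∏ i, r (w i) := fun w => by
      have := (hr w).ne'
      field_simp
      ring
    have e' : ∀ w : Fin m → Fin 4, (∏ i, r (w i))⁻¹ * (c * ∏ i, r (w i)) ^ 2 =
        c ^ 2 * ∏ i, r (w i) := fun w => by
      have := (hr w).ne'
      field_simp
    simp only [h2, e', ← Finset.mul_sum, sum_word_prod r hHr.sum_eq_one] at h1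
    simp only [e, Finset.sum_add_distrib, Finset.sum_sub_distrib, ← Finset.mul_sum,
      sum_wordIncrement, sum_word_prod r hHr.sum_eq_one]
    rw [← hc]
    linarith
  have h4 := (Finset.sum_eq_zero_iff_of_nonneg fun w _ =>
    mul_nonneg (inv_nonneg.2 (hr w).le) (sq_nonneg _)).1
      (h3.antisymm (Finset.sum_nonneg fun w _ =>
        mul_nonneg (inv_nonneg.2 (hr w).le) (sq_nonneg _))) w (Finset.mem_univ w)
  have h5 := (mul_eq_zero.1 h4).resolve_left (inv_ne_zero (hr w).ne')
  exact sub_eq_zero.1 (pow_eq_zero_iff two_ne_zero |>.1 h5)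

/-- A function whose increments are proportional to a probability vector on words takes, at all
vertices, values between those at the two end points. -/
theorem exists_vertex_eq_add_mul {ρ : Fin 4 → ℝ} (hρ0 : ∀ n, 0 ≤ ρ n) (hρ : ∑ n, ρ n = 1)
    {m : ℕ} (w : Fin m → Fin 4) (j : Fin 2) (g : Plane → ℝ) (c : ℝ)
    (hg : ∀ (m : ℕ) (w : Fin m → Fin 4), wordIncrement g w = c * ∏ i, ρ (w i)) :
    ∃ t ∈ Icc (0 : ℝ) 1, g (kochWord w (kochEnd j)) = g (kochEnd 0) + c * t := by
  induction m generalizing g c with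
  | zero =>
    fin_cases j
    · exact ⟨0, by simp, by simp [kochWord]⟩
    · have := hg 0 Fin.elim0
      simp only [wordIncrement, kochWord, Finset.univ_eq_empty, Finset.prod_empty, mul_one] at this
      exact ⟨1, by simp, by simp [kochWord]; linarith⟩
  | succ m ih =>
    obtain ⟨t, ht, he⟩ := ih (Fin.tail w) (fun x => g (kochMap (w 0) x)) (c * ρ (w 0))
      fun k v => by
        rw [← wordIncrement_cons, hg, Fin.prod_univ_succ]
        simp [mul_assoc]
    have hstart : ∀ n, g (kochMap n (kochEnd 0)) = g (kochEnd 0) + c * ∑ k ∈ Finset.Iio n, ρ k := by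
      intro n
      induction n using Fin.induction with
      | zero => simp [kochMap_zero_kochEnd, show Finset.Iio (0 : Fin 4) = ∅ from rfl]
      | succ n ihn =>
        have h1 := hg 1 fun _ => n.castSucc
        simp only [wordIncrement, kochWord, Finset.univ_unique, Finset.prod_const,
          Finset.card_singleton, pow_one, kochMap_kochEnd_one, ihn] at h1
        have h2 : Finset.Iio n.succ = Finset.Iic n.castSucc := by
          ext k
          simp [Fin.lt_def, Fin.le_def]
        rw [h2, ← Finset.sum_Iio_add_eq_sum_Iic]
        linarith
    have hle : ∑ k ∈ Finset.Iio (w 0), ρ k + ρ (w 0) ≤ 1 := by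
      rw [Finset.sum_Iio_add_eq_sum_Iic, ← hρ]
      exact Finset.sum_le_univ_sum_of_nonneg hρ0
    have hge : 0 ≤ ∑ k ∈ Finset.Iio (w 0), ρ k := Finset.sum_nonneg fun k _ => hρ0 k
    refine ⟨∑ k ∈ Finset.Iio (w 0), ρ k + ρ (w 0) * t,
      ⟨add_nonneg hge (mul_nonneg (hρ0 _) ht.1), ?_⟩, ?_⟩
    · linarith [mul_le_mul_of_nonneg_left ht.2 (hρ0 (w 0))]
    · simp only [hstart] at he
      rw [kochWord, he]
      ring

/-- On the whole curve, vertex values lie between the end values, and density of the vertices with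
continuity extends this to all points. A smaller cell reduces to this case, since `g ∘ kochMap n`
satisfies the same hypothesis with `c * ρ n`. -/
theorem abs_sub_le_of_wordIncrement {ρ : Fin 4 → ℝ} (hρ0 : ∀ n, 0 ≤ ρ n) (hρ : ∑ n, ρ n = 1)
    {g : Plane → ℝ} {c : ℝ} (hgc : ContinuousOn g kochCurve)
    (hg : ∀ (m : ℕ) (w : Fin m → Fin 4), wordIncrement g w = c * ∏ i, ρ (w i))
    {m : ℕ} (w : Fin m → Fin 4) {x y : Plane} (hx : x ∈ kochCurve) (hy : y ∈ kochCurve) :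
    |g (kochWord w x) - g (kochWord w y)| ≤ |c| * ∏ i, ρ (w i) := by
  induction m generalizing g c with
  | zero =>
    have hV : ∀ z ∈ kochCurve, g z ∈ segment ℝ (g (kochEnd 0)) (g (kochEnd 0) + c) := by
      intro z hz
      have hcl : IsClosed (segment ℝ (g (kochEnd 0)) (g (kochEnd 0) + c)) := by
        rw [segment_eq_uIcc]; exact isClosed_Icc
      have hmaps : MapsTo g (⋃ m, kochVertices m)
          (segment ℝ (g (kochEnd 0)) (g (kochEnd 0) + c)) := by
        intro v hv
        obtain ⟨k, v', j, rfl⟩ := mem_iUnion.1 hv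
        obtain ⟨t, ht, he⟩ := exists_vertex_eq_add_mul hρ0 hρ v' j g c hg
        rw [he, segment_eq_image']
        exact ⟨t, ht, by simp [mul_comm]⟩
      have := hmaps.closure_of_continuousOn hgc hz
      rwa [hcl.closure_eq] at this
    have h1 := hV x hx
    have h2 := hV y hy
    rw [segment_eq_uIcc] at h1 h2
    simpa [kochWord] using Set.abs_sub_le_of_uIcc_subset_uIcc (uIcc_subset_uIcc h2 h1)
  | succ m ih =>
    have h1 := ih (g := fun x => g (kochMap (w 0) x)) (c := c * ρ (w 0))
      (hgc.comp (continuous_kochMap _).continuousOn fun x hx => kochMap_mem_kochCurve _ hx)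
      (fun k v => by
        rw [← wordIncrement_cons, hg, Fin.prod_univ_succ]
        simp [mul_assoc]) (Fin.tail w)
    rw [abs_mul, abs_of_nonneg (hρ0 _), mul_assoc] at h1
    rw [Fin.prod_univ_succ]
    exact h1

/-! ### Oscillation of the interpolation function -/

theorem upperLipschitz_nonneg (J : Set ℝ) (s : ℝ → ℝ) : 0 ≤ upperLipschitz J s :=
  Real.sSup_nonneg (by rintro _ ⟨x, -, y, -, -, rfl⟩; positivity)

theorem IsEdelsteinOn.abs_sub_le {J : Set ℝ} {s : ℝ → ℝ} (hs : IsEdelsteinOn J s) {x y : ℝ}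
    (hx : x ∈ J) (hy : y ∈ J) : |s x - s y| ≤ upperLipschitz J s * |x - y| := by
  rcases eq_or_ne x y with rfl | hne
  · simp
  rw [← div_le_iff₀ (abs_pos.2 (sub_ne_zero.2 hne))]
  refine le_csSup ⟨1, ?_⟩ ⟨x, hx, y, hy, hne, rfl⟩
  rintro _ ⟨a, ha, b, hb, hab, rfl⟩
  exact div_le_one_of_le₀ (hs.2 a ha b hb hab).le dist_nonneg

/-- The oscillations of the interpolation function on the cells of level `m` add up to at most
a constant times `M ^ m`. -/
theorem exists_sum_oscillation_le {H : Matrix (Fin 2) (Fin 2) ℝ} {r : Fin 4 → ℝ}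
    (hHr : IsRegularHarmonicStructure H r) {J : Set ℝ} {u : Plane → ℝ} {h : Fin 4 → Plane → ℝ}
    {s : Fin 4 → ℝ → ℝ} (hIFS : IsNonlinearKochIFS H r J u h s) {f : Plane → ℝ}
    (hf : IsNonlinearKochFIF J u h s f) {M : ℝ} (hM : 2 ≤ M)
    (hμ : ∑ n, upperLipschitz J (s n) ≤ M) :
    ∃ A : ℝ, 0 ≤ A ∧ ∀ m : ℕ, ∃ B : (Fin m → Fin 4) → ℝ, (∀ w, 0 ≤ B w) ∧
      (∀ w, ∀ x ∈ kochCurve, ∀ y ∈ kochCurve, |f (kochWord w x) - f (kochWord w y)| ≤ B w) ∧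
      ∑ w, B w ≤ A * M ^ m := by
  set c : Fin 4 → ℝ := fun n => h n (kochEnd 1) - h n (kochEnd 0) with hc
  set C := ∑ n, |c n| with hC
  have hC0 : 0 ≤ C := Finset.sum_nonneg fun n _ => abs_nonneg _
  have hJ := hIFS.compact.isBounded
  -- Adding `C` absorbs the inhomogeneous term: `S' ≤ M * S + C` gives `S' + C ≤ M * S + 2 * C ≤ M *
  -- (S + C)`, and this is where `2 ≤ M` enters.
  suffices hmain : ∀ m : ℕ, ∃ B : (Fin m → Fin 4) → ℝ, (∀ w, 0 ≤ B w) ∧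
      (∀ w, ∀ x ∈ kochCurve, ∀ y ∈ kochCurve, |f (kochWord w x) - f (kochWord w y)| ≤ B w) ∧
      ∑ w, B w + C ≤ (Metric.diam J + C) * M ^ m by
    refine ⟨Metric.diam J + C, add_nonneg Metric.diam_nonneg hC0, fun m => ?_⟩
    obtain ⟨B, h1, h2, h3⟩ := hmain m
    exact ⟨B, h1, h2, by linarith⟩
  intro m
  induction m with
  | zero =>
    exact ⟨fun _ => Metric.diam J, fun _ => Metric.diam_nonneg, fun w x hx y hy =>
      Metric.dist_le_diam_of_mem hJ (hf.mapsTo hx) (hf.mapsTo hy), by simp⟩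
  | succ m ih =>
    obtain ⟨B, h1, h2, h3⟩ := ih
    have hL := fun n => upperLipschitz_nonneg J (s n)
    have hr : ∀ w : Fin m → Fin 4, 0 ≤ ∏ i, r (w i) := fun w =>
      Finset.prod_nonneg fun i _ => (hHr.pos _).le
    refine ⟨fun w => upperLipschitz J (s (w 0)) * B (Fin.tail w) +
      |c (w 0)| * ∏ i, r (Fin.tail w i), fun w => ?_, fun w x hx y hy => ?_, ?_⟩
    · exact add_nonneg (mul_nonneg (hL _) (h1 _)) (mul_nonneg (abs_nonneg _) (hr _))
    · have kx := kochWord_mem_kochCurve (Fin.tail w) hx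
      have ky := kochWord_mem_kochCurve (Fin.tail w) hy
      rw [kochWord, kochWord, hf.invariant _ _ kx, hf.invariant _ _ ky, add_sub_add_comm]
      refine (abs_add_le _ _).trans (add_le_add ?_ ?_)
      · exact ((hIFS.edelstein _).abs_sub_le (hf.mapsTo kx) (hf.mapsTo ky)).trans
          (mul_le_mul_of_nonneg_left (h2 _ x hx y hy) (hL _))
      · exact abs_sub_le_of_wordIncrement (fun n => (hHr.pos n).le) hHr.sum_eq_one
          (hIFS.harmonic _).1 (fun k v => (hIFS.harmonic _).wordIncrement_eq hHr v) _ hx hy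
    · rw [sum_word_succ]
      simp only [Fin.cons_zero, Fin.tail_cons, Finset.sum_add_distrib, ← Finset.mul_sum,
        sum_word_prod r hHr.sum_eq_one, mul_one, ← Finset.sum_mul]
      have hB : 0 ≤ ∑ w, B w := Finset.sum_nonneg fun w _ => h1 w
      rw [← hC, pow_succ, ← mul_assoc]
      nlinarith [mul_le_mul_of_nonneg_right hμ hB, mul_le_mul_of_nonneg_right h3 (by linarith : 0 ≤ M)]

/-! ### Box counting -/

theorem exists_nat_mem_Icc {a x δ : ℝ} (hδ : 0 < δ) {N : ℕ} (h1 : a ≤ x) (h2 : x < a + N * δ) :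
    ∃ i < N, x ∈ Icc (a + i * δ) (a + i * δ + δ) := by
  have h0 : 0 ≤ (x - a) / δ := div_nonneg (by linarith) hδ.le
  refine ⟨⌊(x - a) / δ⌋₊, (Nat.floor_lt h0).2 ((div_lt_iff₀ hδ).2 (by linarith)), ?_, ?_⟩
  · have := (le_div_iff₀ hδ).1 (Nat.floor_le h0)
    linarith
  · have := (div_lt_iff₀ hδ).1 (Nat.lt_floor_add_one ((x - a) / δ))
    linarith

theorem boxCount_le_sum {ι : Type*} [Fintype ι] {F : Set Space} {δ : ℝ} (hδ : 0 < δ)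
    (a : ι → Space) (N : ι → Fin 3 → ℕ)
    (hF : ∀ x ∈ F, ∃ k, ∀ i, a k i ≤ x i ∧ x i < a k i + N k i * δ) :
    boxCount F δ ≤ ∑ k, ∏ i, N k i := by
  classical
  let t : Finset Space :=
    (Finset.univ.sigma fun k => Fintype.piFinset fun i => Finset.range (N k i)).image
      fun p : (_ : ι) × (Fin 3 → ℕ) => WithLp.toLp 2 fun i => a p.1 i + p.2 i * δ
  have ht : F ⊆ ⋃ b ∈ t, cube b δ := by
    intro x hx
    obtain ⟨k, hk⟩ := hF x hx
    choose p hp hpx using fun i => exists_nat_mem_Icc hδ (hk i).1 (hk i).2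
    refine mem_iUnion₂.2 ⟨_, Finset.mem_image.2 ⟨⟨k, p⟩, ?_, rfl⟩, fun i => hpx i⟩
    simpa using hp
  calc boxCount F δ ≤ t.card := Nat.sInf_le ⟨t, rfl, ht⟩
    _ ≤ _ := Finset.card_image_le
    _ = _ := by simp [Finset.card_sigma]

theorem upperBoxDim_le_of_boxCount_le {F : Set Space} {C q : ℝ} (hC : 1 ≤ C) (hq : 1 ≤ q)
    (h : ∀ (m : ℕ) (δ : ℝ), (1 / 3) ^ (m + 1) < δ → δ ≤ (1 / 3) ^ m →
      (boxCount F δ : ℝ) ≤ C * q ^ m) :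
    upperBoxDim F ≤ ((Real.log q / Real.log 3 : ℝ) : EReal) := by
  have hlim : Tendsto (fun δ : ℝ => Real.log C / -Real.log δ + Real.log q / Real.log 3) (𝓝[>] 0)
      (𝓝 (Real.log q / Real.log 3)) := by
    have h1 : Tendsto (fun δ : ℝ => -Real.log δ) (𝓝[>] 0) atTop :=
      tendsto_neg_atBot_atTop.comp Real.tendsto_log_nhdsGT_zero
    simpa using (h1.const_div_atTop (Real.log C)).add_const (Real.log q / Real.log 3)
  have hlim' := (continuous_coe_real_ereal.tendsto _).comp hlim
  rw [← hlim'.limsup_eq]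
  refine limsup_le_limsup ?_
  filter_upwards [Ioo_mem_nhdsGT (zero_lt_one (α := ℝ))] with δ hδ
  simp only [Function.comp_apply, EReal.coe_le_coe_iff]
  obtain ⟨m, hm1, hm2⟩ := exists_nat_pow_near_of_lt_one hδ.1 hδ.2.le
    (by norm_num : (0 : ℝ) < 1 / 3) (by norm_num)
  have hlog : 0 < -Real.log δ := neg_pos.2 (Real.log_neg hδ.1 hδ.2)
  have h3 : 0 < Real.log 3 := Real.log_pos (by norm_num)
  have hqm : 1 ≤ q ^ m := one_le_pow₀ hq
  have hN : Real.log (boxCount F δ) ≤ Real.log C + m * Real.log q := by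
    rw [← Real.log_pow, ← Real.log_mul (by positivity) (by positivity)]
    -- For a zero count `Real.log 0 = 0`, which is harmless because `1 ≤ C * q ^ m`.
    rcases (boxCount F δ).eq_zero_or_pos with h0 | h0
    · rw [h0, Nat.cast_zero, Real.log_zero]
      exact Real.log_nonneg (by nlinarith)
    · exact Real.log_le_log (by exact_mod_cast h0) (h m δ hm1 hm2)
  have hm : m * Real.log 3 ≤ -Real.log δ := by
    have := Real.log_le_log hδ.1 hm2
    rw [Real.log_pow, one_div, Real.log_inv] at this
    linarith
  rw [div_le_iff₀ hlog, add_mul, div_mul_cancel₀ _ hlog.ne']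
  refine hN.trans (add_le_add_right ?_ _)
  rw [div_mul_eq_mul_div, le_div_iff₀ h3]
  nlinarith [Real.log_nonneg hq]

theorem exists_boxCount_graphOver_le {f : Plane → ℝ} {A M : ℝ} (hA : 0 ≤ A) (hM : 2 ≤ M)
    (hf : ∀ m : ℕ, ∃ B : (Fin m → Fin 4) → ℝ, (∀ w, 0 ≤ B w) ∧
      (∀ w, ∀ x ∈ kochCurve, ∀ y ∈ kochCurve, |f (kochWord w x) - f (kochWord w y)| ≤ B w) ∧
      ∑ w, B w ≤ A * M ^ m) :
    ∃ C : ℝ, 1 ≤ C ∧ ∀ (m : ℕ) (δ : ℝ), (1 / 3) ^ (m + 1) < δ → δ ≤ (1 / 3) ^ m →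
      (boxCount (graphOver kochCurve f) δ : ℝ) ≤ C * (3 * M) ^ m := by
  obtain ⟨o, ho⟩ := nonempty_kochCurve
  -- A cell has diameter at most `3 ^ (-m) * diam`, which is below `Q * δ` because `3 ^ (-m) < 3 *
  -- δ`; so `2 * Q` cubes suffice in each horizontal direction.
  obtain ⟨Q, hQ⟩ := exists_nat_gt (3 * Metric.diam kochCurve)
  have hQ0 : (0 : ℝ) ≤ 3 * Metric.diam kochCurve := by
    have := Metric.diam_nonneg (s := kochCurve); linarith
  have hQ1 : (1 : ℝ) ≤ Q := by
    have : (0 : ℝ) < Q := hQ0.trans_lt hQ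
    exact_mod_cast this
  refine ⟨(2 * Q) ^ 2 * (6 * A + 2), by nlinarith, fun m δ h1 h2 => ?_⟩
  obtain ⟨B, hB0, hB, hBs⟩ := hf m
  have hδ : 0 < δ := lt_trans (by positivity) h1
  have h1' : (1 / 3 : ℝ) ^ m < 3 * δ := by rw [pow_succ] at h1; linarith
  have hcount := boxCount_le_sum (F := graphOver kochCurve f) hδ
    (fun w : Fin m → Fin 4 => graphPoint (kochWord w o - WithLp.toLp 2 fun _ => Q * δ)
      (f (kochWord w o) - B w))
    -- Over the cell, `f` stays within `B w` of its value at the base point; the `+ 1` gives the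
    -- strict upper bound and accounts for the `4 ^ m` term.
    (fun w => ![2 * Q, 2 * Q, ⌊2 * B w / δ⌋₊ + 1]) (by
      rintro _ ⟨x, hx, rfl⟩
      obtain ⟨w, y, hy, rfl⟩ := exists_kochWord_eq m hx
      have hd : dist (kochWord w y) (kochWord w o) < Q * δ := by
        rw [dist_kochWord]
        calc (1 / 3 : ℝ) ^ m * dist y o ≤ 3 * δ * Metric.diam kochCurve := by
              gcongr
              exact Metric.dist_le_diam_of_mem isCompact_kochCurve.isBounded hy ho
          _ < Q * δ := by nlinarith
      have hi : ∀ i, |kochWord w y i - kochWord w o i| < Q * δ := fun i =>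
        (PiLp.norm_apply_le (kochWord w y - kochWord w o) i).trans_lt (by rwa [← dist_eq_norm])
      have hz := abs_le.1 (hB w y hy o ho)
      have hfl := (div_lt_iff₀ hδ).1 (Nat.lt_floor_add_one (2 * B w / δ))
      have h0 := abs_lt.1 (hi 0)
      have h1 := abs_lt.1 (hi 1)
      refine ⟨w, fun i => ?_⟩
      fin_cases i <;> simp [graphPoint] <;> constructor <;> linarith)
  have hsum : ((∑ w : Fin m → Fin 4, ∏ i, (![2 * Q, 2 * Q, ⌊2 * B w / δ⌋₊ + 1] : Fin 3 → ℕ) i : ℕ) : ℝ)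
      ≤ (2 * Q) ^ 2 * (2 * (∑ w, B w) / δ + 4 ^ m) := by
    simp only [Fin.prod_univ_three, Matrix.cons_val, ← Finset.mul_sum]
    push_cast
    rw [← sq]
    refine mul_le_mul_of_nonneg_left ?_ (by positivity)
    rw [Finset.sum_add_distrib, Finset.mul_sum, Finset.sum_div]
    refine add_le_add (Finset.sum_le_sum fun w _ => Nat.floor_le ?_) (by simp)
    have := hB0 w
    positivity
  have hδi : 1 / δ ≤ 3 * 3 ^ m := by
    rw [div_le_iff₀ hδ]
    rw [one_div, inv_pow, inv_lt_iff_one_lt_mul₀ (by positivity)] at h1'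
    linarith
  refine (Nat.cast_le.2 hcount).trans (hsum.trans ?_)
  rw [mul_assoc]
  refine mul_le_mul_of_nonneg_left ?_ (by positivity)
  have h4 : (4 : ℝ) ^ m ≤ (3 * M) ^ m := pow_le_pow_left₀ (by norm_num) (by linarith) m
  have hS : 0 ≤ ∑ w, B w := Finset.sum_nonneg fun w _ => hB0 w
  have h5 : 2 * (∑ w, B w) / δ ≤ 2 * (A * M ^ m) * (3 * 3 ^ m) := by
    rw [div_eq_mul_one_div]
    gcongr
  have h6 : 0 < (3 * M) ^ m := by positivity
  rw [mul_pow] at h4 h6 ⊢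
  nlinarith

theorem theorem4p2
    (H : Matrix (Fin 2) (Fin 2) ℝ) (r : Fin 4 → ℝ) (hHr : IsRegularHarmonicStructure H r)
    (J : Set ℝ) (u : Plane → ℝ) (h : Fin 4 → Plane → ℝ) (s : Fin 4 → ℝ → ℝ)
    (hIFS : IsNonlinearKochIFS H r J u h s)
    (hu : ¬ Coplanar ℝ (graphOver (kochVertices 1) u))
    (f : Plane → ℝ) (hf : IsNonlinearKochFIF J u h s f)
    (μ : ℝ) (hμ : μ = ∑ n, upperLipschitz J (s n)) :
    (2 < μ → upperBoxDim (graphOver kochCurve f)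
      ≤ ((1 + Real.log μ / Real.log 3 : ℝ) : EReal)) ∧
    (μ ≤ 2 → upperBoxDim (graphOver kochCurve f)
      ≤ ((Real.log 6 / Real.log 3 : ℝ) : EReal)) := by
  -- One bound serves both cases: `M = μ` splits the logarithm into `1 + log μ / log 3`, and `M = 2`
  -- gives `log 6 / log 3`.
  have key : ∀ M : ℝ, 2 ≤ M → μ ≤ M → upperBoxDim (graphOver kochCurve f)
      ≤ ((Real.log (3 * M) / Real.log 3 : ℝ) : EReal) := fun M hM hle => by
    obtain ⟨A, hA, hosc⟩ := exists_sum_oscillation_le hHr hIFS hf hM (hμ ▸ hle)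
    obtain ⟨C, hC, hN⟩ := exists_boxCount_graphOver_le hA hM hosc
    exact upperBoxDim_le_of_boxCount_le hC (by linarith) hN
  refine ⟨fun h2 => ?_, fun h2 => ?_⟩
  · have h3 : Real.log 3 ≠ 0 := (Real.log_pos (by norm_num)).ne'
    have := key μ h2.le le_rfl
    rwa [Real.log_mul (by norm_num) (by linarith), add_div, div_self h3] at this
  · have := key 2 le_rfl h2
    rwa [show (3 : ℝ) * 2 = 6 by norm_num] at this
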